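/- **Multi-Schatten-$p$ norm surrogate.** For $A\in\mathbb R^{a\times b}$ with singular values $\sigma_1(A)\ge\sigma_2(A)\ge\dots$ and $0<p<\infty$, let $\|A\|_{S_p}=\bigl(\sum_{j=1}^{\min\{a,b\}}\sigma_j(A)^p\bigr)^{1/p}$. Let $I\ge 2$, let $m=d_0,d_1,\dots,d_{I-1},d_I=n$ be dimensions, and let $X\in\mathbb R^{m\times n}$ satisfy $\operatorname{rank}X\le d_i$ for $i=1,\dots,I-1$. Let $p,p_1,\dots,p_I>0$ satisfy $\frac1p=\sum_{i=1}^I\frac1{p_i}$. Then $$\frac1p\|X\|_{S_p}^p=\min\Bigl\{\sum_{i=1}^I\frac1{p_i}\|X_i\|_{S_{p_i}}^{p_i}\;:\;X_i\in\mathbb R^{d_{i-1}\times d_i}\ (1\le i\le I),\ X_1X_2\cdots X_I=X\Bigr\},$$ and the minimum is attained. Moreover, for every singular value decomposition $X=U\Sigma V^{T}$ ($U\in\mathbb R^{m\times m}$ and $V\in\mathbb R^{n\times n}$ orthogonal, $\Sigma\in\mathbb R^{m\times n}$ with the singular values of $X$ in descending order on its diagonal and zeros elsewhere), a minimizer is given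 by $$X_1=U\,\Sigma_{1},\qquad X_i=\Sigma_{i}\ (1<i<I),\qquad X_I=\Sigma_{I}\,V^{T},$$ where $\Sigma_i$ is the $d_{i-1}\times d_i$ matrix with diagonal entries $\sigma_1(X)^{p/p_i},\sigma_2(X)^{p/p_i},\dots$ (with $\sigma_j(X)=0$ for $j>\min\{m,n\}$) and zeros elsewhere. -/

import Mathlib

/-- The singular values `σ₀ ≥ σ₁ ≥ …` of a real matrix, as those of the linear map
`x ↦ X x` between Euclidean spaces. The indices start from `0`; the sequence is
continued by zeros past the dimension of the domain. -/
noncomputable def matrixSingularValue {m n : ℕ} (X : Matrix (Fin m) (Fin n) ℝ) (k : ℕ) : ℝ :=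
  (Matrix.toEuclideanLin X).singularValues k

/-- The Schatten-`p` (quasi-)norm `(∑_{k < min m n} σ_k(X)^p)^(1/p)`, for `0 < p < ∞`. -/
noncomputable def schattenNorm {m n : ℕ} (p : ℝ) (X : Matrix (Fin m) (Fin n) ℝ) : ℝ :=
  (∑ k ∈ Finset.range (min m n), matrixSingularValue X k ^ p) ^ (1 / p)

/-- A list of `I` real matrices in which neighbours can be multiplied: the `i`-th one
is of size `d i × d (i + 1)`. -/
abbrev FactorChain {I : ℕ} (d : Fin (I + 1) → ℕ) : Type :=
  (i : Fin I) → Matrix (Fin (d i.castSucc)) (Fin (d i.succ)) ℝ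

/-- The product `A 0 * A 1 * ⋯ * A (I - 1)` (the identity for `I = 0`). -/
def FactorChain.prod : {I : ℕ} → {d : Fin (I + 1) → ℕ} → FactorChain d →
    Matrix (Fin (d 0)) (Fin (d (Fin.last I))) ℝ
  | 0, d, _ => (1 : Matrix (Fin (d 0)) (Fin (d 0)) ℝ)
  | _ + 1, d, A => A 0 * FactorChain.prod (d := fun i => d i.succ) (fun i => A i.succ)

/-- The `a × b` matrix with entries `s 0, s 1, …` on its main diagonal and zeros elsewhere. -/
def rectDiagonal (a b : ℕ) (s : ℕ → ℝ) : Matrix (Fin a) (Fin b) ℝ :=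
  Matrix.of fun i j => if (i : ℕ) = (j : ℕ) then s i else 0

/-- `X = U Σ Vᵀ` is a (full) singular value decomposition: `U` and `V` are orthogonal and
`Σ` is the rectangular diagonal matrix of the singular values in descending order. -/
def IsSVD {m n : ℕ} (X : Matrix (Fin m) (Fin n) ℝ)
    (U : Matrix (Fin m) (Fin m) ℝ) (V : Matrix (Fin n) (Fin n) ℝ) : Prop :=
  U ∈ Matrix.orthogonalGroup (Fin m) ℝ ∧ V ∈ Matrix.orthogonalGroup (Fin n) ℝ ∧
    X = U * rectDiagonal m n (matrixSingularValue X) * V.transpose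

/-!
The lower bound rests on Horn's inequality: for a chain `X = A 0 * ⋯ * A (I - 1)` and every `k`,
the product of the `k` largest singular values of `X` is at most the product over `i` of the
corresponding products for the `A i`. It holds because `σ₀ ⋯ σ_{k-1}` is the operator norm of the
`k`-th exterior power of a linear map, which is submultiplicative. In concrete terms this is
`det_gram_map_le`: a linear map `T` multiplies Gram determinants of `k` vectors by at most
`(σ₀ ⋯ σ_{k-1})²`, with equality at the leading right singular vectors
(`exists_det_gram_map_eq`); two applications give `prod_singularValues_comp_le`.

Horn's inequality is a weak log-majorization, so it passes to sums of `p`-th powers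
(`sum_le_sum_of_prod_le_prod`, by `b ≥ a (1 + log (b / a))` and summation by parts). Weighted
AM-GM with the weights `p / q i`, which add up to `1`, bounds each `∏ i, σ_j(A i) ^ p` by
`p * ∑ i, σ_j(A i) ^ q i / q i`, and summing over `j` gives `FactorChain.schattenNorm_prod_le`.

For attainment, a singular value decomposition exists (`exists_isSVD`). The proposed factors are
`W i * D i * (W (i + 1))ᵀ` with rectangular diagonal `D i` and orthogonal `W`, namely `U` and `V` at
the ends and identities inside. The product telescopes (`FactorChain.prod_conj`), the diagonals
multiply entrywise since the inner dimensions are at least the rank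
(`FactorChain.prod_rectDiagonal`), and the Schatten norms are read off from the characteristic
polynomial of `Bᵀ * B` (`schattenNorm_rpow_orthogonal_mul_rectDiagonal`), so no sorting of singular
values is needed.
-/

open scoped RealInnerProductSpace

/-! ### Horn's inequality for linear maps -/

section CompoundBound

variable {E F G : Type*} [NormedAddCommGroup E] [InnerProductSpace ℝ E] [FiniteDimensional ℝ E]
  [NormedAddCommGroup F] [InnerProductSpace ℝ F] [FiniteDimensional ℝ F]
  [NormedAddCommGroup G] [InnerProductSpace ℝ G] [FiniteDimensional ℝ G]

/-- The right singular vectors of `T`: an orthonormal eigenbasis of `T* T`, ordered so that the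
`i`-th vector belongs to the `i`-th singular value. -/
noncomputable def rightSingularBasis (T : E →ₗ[ℝ] F) :
    OrthonormalBasis (Fin (Module.finrank ℝ E)) ℝ E :=
  T.isSymmetric_adjoint_comp_self.eigenvectorBasis rfl

theorem inner_map_rightSingularBasis (T : E →ₗ[ℝ] F) (i : Fin (Module.finrank ℝ E)) (w : E) :
    ⟪T (rightSingularBasis T i), T w⟫ =
      T.singularValues i ^ 2 * ⟪rightSingularBasis T i, w⟫ := by
  have h := T.isSymmetric_adjoint_comp_self.apply_eigenvectorBasis rfl i
  rw [← LinearMap.adjoint_inner_left, ← LinearMap.comp_apply]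
  unfold rightSingularBasis
  rw [h, T.sq_singularValues_fin rfl i]
  simp [inner_smul_left]

open exteriorPower in
/-- The exterior power of `T` maps the orthonormal basis induced by the right singular vectors to
orthogonal vectors, whose norms are products of `k` singular values. -/
theorem inner_exteriorPower_map_basis (T : E →ₗ[ℝ] F) (k : ℕ)
    (s t : Set.powersetCard (Fin (Module.finrank ℝ E)) k) :
    ⟪map k T ((rightSingularBasis T).exteriorPower k s),
      map k T ((rightSingularBasis T).exteriorPower k t)⟫ =
      if s = t then ∏ i : Fin k, T.singularValues (Set.powersetCard.ofFinEmbEquiv.symm s i) ^ 2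
      else 0 := by
  have hb : ∀ u, (rightSingularBasis T).exteriorPower k u =
      ιMulti ℝ k (rightSingularBasis T ∘ Set.powersetCard.ofFinEmbEquiv.symm u) := by
    intro u
    rw [← OrthonormalBasis.coe_toBasis, OrthonormalBasis.toBasis_exteriorPower, coe_basis]
    simp [ιMulti_family]
  have horth : ⟪(rightSingularBasis T).exteriorPower k s, (rightSingularBasis T).exteriorPower k t⟫
      = if s = t then 1 else 0 :=
    orthonormal_iff_ite.mp ((rightSingularBasis T).exteriorPower k).orthonormal s t
  rw [hb, hb, inner_ιMulti_ιMulti] at horth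
  rw [hb, hb, map_apply_ιMulti, map_apply_ιMulti, inner_ιMulti_ιMulti]
  simp only [Function.comp_apply, inner_map_rightSingularBasis] at horth ⊢
  have := Matrix.det_mul_row
    (fun j => T.singularValues (Set.powersetCard.ofFinEmbEquiv.symm s j) ^ 2)
    (Matrix.of fun i j => ⟪rightSingularBasis T (Set.powersetCard.ofFinEmbEquiv.symm s j),
      rightSingularBasis T (Set.powersetCard.ofFinEmbEquiv.symm t i)⟫)
  simp only [Matrix.of_apply] at this
  rw [this, horth]
  split_ifs <;> simp

/-- The `k`-th exterior power of `T` has operator norm at most `σ₀ ⋯ σ_{k-1}`. -/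
theorem inner_exteriorPower_map_self_le (T : E →ₗ[ℝ] F) (k : ℕ) (x : ⋀[ℝ]^k E) :
    ⟪exteriorPower.map k T x, exteriorPower.map k T x⟫ ≤
      (∏ j ∈ Finset.range k, T.singularValues j) ^ 2 * ⟪x, x⟫ := by
  set b := (rightSingularBasis T).exteriorPower k with hb
  have hx : ⟪x, x⟫ = ∑ s, b.repr x s ^ 2 := by
    rw [real_inner_self_eq_norm_sq, ← b.repr.norm_map, EuclideanSpace.real_norm_sq_eq]
  have hTx : ⟪exteriorPower.map k T x, exteriorPower.map k T x⟫ = ∑ s, b.repr x s ^ 2 *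
      ∏ i : Fin k, T.singularValues (Set.powersetCard.ofFinEmbEquiv.symm s i) ^ 2 := by
    conv_lhs => rw [← b.sum_repr x]
    simp only [map_sum, map_smul, sum_inner, inner_sum, inner_smul_left, inner_smul_right, hb,
      inner_exteriorPower_map_basis]
    simp [pow_two, mul_assoc]
  rw [hTx, hx, Finset.mul_sum]
  refine Finset.sum_le_sum fun s _ => ?_
  rw [mul_comm]
  refine mul_le_mul_of_nonneg_right ?_ (sq_nonneg _)
  rw [Finset.prod_pow]
  have hnn : ∀ j, 0 ≤ T.singularValues j := T.singularValues_nonneg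
  refine pow_le_pow_left₀ (Finset.prod_nonneg fun i _ => hnn _) ?_ 2
  rw [← Fin.prod_univ_eq_prod_range]
  refine Finset.prod_le_prod (fun i _ => hnn _) fun i hi => T.singularValues_antitone ?_
  -- The `i`-th element of a `k`-element set of naturals is at least `i`.
  have hmono : StrictMono fun i : Fin k =>
      ((Set.powersetCard.ofFinEmbEquiv.symm s i : Fin (Module.finrank ℝ E)) : ℕ) :=
    fun a c hac => (Set.powersetCard.ofFinEmbEquiv.symm s).strictMono hac
  obtain ⟨j, hj⟩ := i
  induction j with
  | zero => exact Nat.zero_le _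
  | succ j ih =>
    exact (Nat.succ_le_succ (ih (by omega) (Finset.mem_univ _))).trans
      (hmono (a := ⟨j, by omega⟩) (b := ⟨j + 1, hj⟩) (Nat.lt_succ_self j))

/-- `T` multiplies the squared volume spanned by `k` vectors by at most `(σ₀ ⋯ σ_{k-1})²`. -/
theorem det_gram_map_le (T : E →ₗ[ℝ] F) {k : ℕ} (v : Fin k → E) :
    (Matrix.gram ℝ (T ∘ v)).det ≤
      (∏ j ∈ Finset.range k, T.singularValues j) ^ 2 * (Matrix.gram ℝ v).det := by
  rw [← exteriorPower.inner_ιMulti_self, ← exteriorPower.inner_ιMulti_self,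
    ← exteriorPower.map_apply_ιMulti]
  exact inner_exteriorPower_map_self_le T k _

/-- The bound of `det_gram_map_le` is attained at the leading right singular vectors. -/
theorem exists_det_gram_map_eq (T : E →ₗ[ℝ] F) {k : ℕ} (hk : k ≤ Module.finrank ℝ E) :
    ∃ v : Fin k → E, (Matrix.gram ℝ v).det = 1 ∧
      (Matrix.gram ℝ (T ∘ v)).det = (∏ j ∈ Finset.range k, T.singularValues j) ^ 2 := by
  have horth : Orthonormal ℝ (rightSingularBasis T ∘ Fin.castLE hk) :=
    (rightSingularBasis T).orthonormal.comp _ (Fin.castLE_injective hk)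
  refine ⟨rightSingularBasis T ∘ Fin.castLE hk, ?_, ?_⟩
  · rw [Matrix.gram_eq_one_iff_orthonormal.mpr horth, Matrix.det_one]
  · have : Matrix.gram ℝ (T ∘ rightSingularBasis T ∘ Fin.castLE hk) =
        Matrix.diagonal fun i : Fin k => T.singularValues i ^ 2 := by
      ext i j
      have := orthonormal_iff_ite.mp horth i j
      simp only [Function.comp_apply] at this
      simp [inner_map_rightSingularBasis, this, Matrix.diagonal_apply]
    rw [this, Matrix.det_diagonal, Finset.prod_pow, ← Fin.prod_univ_eq_prod_range]

/-- **Horn's inequality** for the products of the leading singular values. -/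
theorem prod_singularValues_comp_le (S : F →ₗ[ℝ] G) (T : E →ₗ[ℝ] F) (k : ℕ) :
    ∏ j ∈ Finset.range k, (S ∘ₗ T).singularValues j ≤
      (∏ j ∈ Finset.range k, S.singularValues j) * ∏ j ∈ Finset.range k, T.singularValues j := by
  have hS := Finset.prod_nonneg fun j (_ : j ∈ Finset.range k) => S.singularValues_nonneg j
  have hT := Finset.prod_nonneg fun j (_ : j ∈ Finset.range k) => T.singularValues_nonneg j
  rcases le_or_gt k (Module.finrank ℝ E) with hk | hk
  · obtain ⟨v, hv, hv'⟩ := exists_det_gram_map_eq (S ∘ₗ T) hk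
    refine le_of_sq_le_sq ?_ (mul_nonneg hS hT)
    rw [← hv', mul_pow]
    calc (Matrix.gram ℝ (S ∘ T ∘ v)).det
        ≤ (∏ j ∈ Finset.range k, S.singularValues j) ^ 2 * (Matrix.gram ℝ (T ∘ v)).det :=
          det_gram_map_le S _
      _ ≤ (∏ j ∈ Finset.range k, S.singularValues j) ^ 2 *
          ((∏ j ∈ Finset.range k, T.singularValues j) ^ 2 * (Matrix.gram ℝ v).det) := by
          gcongr
          exact det_gram_map_le T v
      _ = _ := by rw [hv, mul_one]
  -- Past the dimension of the domain there are no `k` orthonormal vectors, but `σ_k = 0` there.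
  · rw [Finset.prod_eq_zero (Finset.mem_range.mpr hk)
      ((S ∘ₗ T).singularValues_of_finrank_le le_rfl)]
    exact mul_nonneg hS hT

end CompoundBound

/-! ### Singular values of matrices and of products of matrices -/

section Chain

theorem matrixSingularValue_nonneg {m n : ℕ} (X : Matrix (Fin m) (Fin n) ℝ) (k : ℕ) :
    0 ≤ matrixSingularValue X k :=
  LinearMap.singularValues_nonneg _ k

theorem matrixSingularValue_antitone {m n : ℕ} (X : Matrix (Fin m) (Fin n) ℝ) :
    Antitone (matrixSingularValue X) :=
  LinearMap.singularValues_antitone _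

theorem matrixSingularValue_pos_iff {m n : ℕ} (X : Matrix (Fin m) (Fin n) ℝ) (k : ℕ) :
    0 < matrixSingularValue X k ↔ k < X.rank := by
  rw [matrixSingularValue, LinearMap.singularValues_pos_iff_lt_finrank_range,
    X.rank_eq_finrank_range_toLin (EuclideanSpace.basisFun _ ℝ).toBasis
      (EuclideanSpace.basisFun _ ℝ).toBasis, Matrix.toEuclideanLin_eq_toLin_orthonormal]

theorem matrixSingularValue_eq_zero {m n : ℕ} (X : Matrix (Fin m) (Fin n) ℝ) {k : ℕ}
    (hk : X.rank ≤ k) : matrixSingularValue X k = 0 :=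
  le_antisymm (not_lt.mp fun h => hk.not_gt ((matrixSingularValue_pos_iff X k).mp h))
    (matrixSingularValue_nonneg X k)

theorem prod_matrixSingularValue_mul_le {l m n : ℕ} (A : Matrix (Fin l) (Fin m) ℝ)
    (B : Matrix (Fin m) (Fin n) ℝ) (k : ℕ) :
    ∏ j ∈ Finset.range k, matrixSingularValue (A * B) j ≤
      (∏ j ∈ Finset.range k, matrixSingularValue A j) *
        ∏ j ∈ Finset.range k, matrixSingularValue B j := by
  have : Matrix.toEuclideanLin (A * B) = Matrix.toEuclideanLin A ∘ₗ Matrix.toEuclideanLin B := by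
    ext x : 1
    simp [Matrix.toLpLin_apply, Matrix.mulVec_mulVec]
  simp only [matrixSingularValue, this]
  exact prod_singularValues_comp_le _ _ k

theorem matrixSingularValue_one_le (m j : ℕ) :
    matrixSingularValue (1 : Matrix (Fin m) (Fin m) ℝ) j ≤ 1 := by
  rcases le_or_gt m j with h | h
  · rw [matrixSingularValue_eq_zero _ (by simpa using h)]
    exact zero_le_one
  · have h1 : Matrix.toEuclideanLin (1 : Matrix (Fin m) (Fin m) ℝ) = LinearMap.id := by
      ext x : 1
      simp
    have := LinearMap.hasEigenvalue_adjoint_comp_self_sq_singularValues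
      (T := Matrix.toEuclideanLin (1 : Matrix (Fin m) (Fin m) ℝ)) (n := j) (by simpa using h)
    obtain ⟨v, hv, hv0⟩ := this.exists_hasEigenvector
    rw [Module.End.mem_eigenspace_iff, h1] at hv
    have hv1 : v = (matrixSingularValue (1 : Matrix (Fin m) (Fin m) ℝ) j ^ 2) • v := by
      simpa [matrixSingularValue, h1] using hv
    have h2 : matrixSingularValue (1 : Matrix (Fin m) (Fin m) ℝ) j ^ 2 = 1 :=
      smul_left_injective ℝ hv0 (by simpa using hv1.symm)
    nlinarith [matrixSingularValue_nonneg (1 : Matrix (Fin m) (Fin m) ℝ) j]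

/-- Horn's inequality for a chain of matrices. -/
theorem FactorChain.prod_matrixSingularValue_le {I : ℕ} {d : Fin (I + 1) → ℕ} (A : FactorChain d)
    (k : ℕ) :
    ∏ j ∈ Finset.range k, matrixSingularValue A.prod j ≤
      ∏ j ∈ Finset.range k, ∏ i, matrixSingularValue (A i) j := by
  rw [Finset.prod_comm]
  induction I with
  | zero =>
    simpa [FactorChain.prod] using
      Finset.prod_le_one (fun j _ => matrixSingularValue_nonneg _ j)
        fun j (_ : j ∈ Finset.range k) => matrixSingularValue_one_le (d 0) j
  | succ I ih =>
    rw [Fin.prod_univ_succ, FactorChain.prod]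
    refine (prod_matrixSingularValue_mul_le _ _ k).trans ?_
    exact mul_le_mul_of_nonneg_left (ih (d := fun i => d i.succ) fun i => A i.succ)
      (Finset.prod_nonneg fun j _ => matrixSingularValue_nonneg _ j)

end Chain

/-! ### Log-majorization and the weighted inequality of means -/

section PowerSums

/-- Summation by parts: a sum weighted by a nonnegative antitone sequence is nonnegative
as soon as all partial sums of the unweighted one are. -/
theorem sum_mul_nonneg_of_antitone {a t : ℕ → ℝ} (ha : Antitone a) (r : ℕ) (ha0 : 0 ≤ a (r - 1))
    (ht : ∀ k ≤ r, 0 ≤ ∑ j ∈ Finset.range k, t j) :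
    0 ≤ ∑ j ∈ Finset.range r, a j * t j := by
  have h := Finset.sum_range_by_parts a t r
  simp only [smul_eq_mul] at h
  rw [h, sub_nonneg]
  refine (Finset.sum_nonpos fun i hi => ?_).trans (mul_nonneg ha0 (ht r le_rfl))
  exact mul_nonpos_of_nonpos_of_nonneg (sub_nonpos.mpr (ha i.le_succ))
    (ht _ (by have := Finset.mem_range.mp hi; omega))

/-- Weak log-majorization implies weak majorization (positive sequences, `a` decreasing). -/
theorem sum_le_sum_of_prod_le_prod {a b : ℕ → ℝ} (ha : Antitone a) (r : ℕ)
    (ha0 : ∀ j < r, 0 < a j) (han : ∀ j, 0 ≤ a j) (hb : ∀ j, 0 ≤ b j)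
    (h : ∀ k ≤ r, ∏ j ∈ Finset.range k, a j ≤ ∏ j ∈ Finset.range k, b j) :
    ∑ j ∈ Finset.range r, a j ≤ ∑ j ∈ Finset.range r, b j := by
  have hbr : ∀ j < r, 0 < b j := by
    intro j hj
    have h1 : 0 < ∏ j ∈ Finset.range r, b j :=
      (Finset.prod_pos fun j hj => ha0 j (Finset.mem_range.mp hj)).trans_le (h r le_rfl)
    exact (hb j).lt_of_ne' (Finset.prod_ne_zero_iff.mp h1.ne' j (Finset.mem_range.mpr hj))
  have key := sum_mul_nonneg_of_antitone (t := fun j => Real.log (b j) - Real.log (a j)) ha r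
    (han _) (by
      intro k hk
      have hlt : ∀ j ∈ Finset.range k, j < r := fun j hj => (Finset.mem_range.mp hj).trans_le hk
      rw [Finset.sum_sub_distrib, ← Real.log_prod fun j hj => (hbr j (hlt j hj)).ne',
        ← Real.log_prod fun j hj => (ha0 j (hlt j hj)).ne', sub_nonneg]
      exact Real.log_le_log (Finset.prod_pos fun j hj => ha0 j (hlt j hj)) (h k hk))
  rw [← sub_nonneg, ← Finset.sum_sub_distrib]
  refine key.trans (Finset.sum_le_sum fun j hj => ?_)
  have hj := Finset.mem_range.mp hj
  rw [← Real.log_div (hbr j hj).ne' (ha0 j hj).ne']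
  calc a j * Real.log (b j / a j) ≤ a j * (b j / a j - 1) :=
        mul_le_mul_of_nonneg_left (Real.log_le_sub_one_of_pos (div_pos (hbr j hj) (ha0 j hj)))
          (han j)
    _ = b j - a j := by
        have := (ha0 j hj).ne'
        field_simp

/-- Young's inequality for several factors, that is, weighted AM-GM with weights `p / q i`. -/
theorem prod_rpow_le_sum_rpow {ι : Type*} [Fintype ι] {p : ℝ} {q : ι → ℝ} (hp : 0 < p)
    (hq : ∀ i, 0 < q i) (hpq : 1 / p = ∑ i, 1 / q i) (x : ι → ℝ) (hx : ∀ i, 0 ≤ x i) :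
    (∏ i, x i) ^ p ≤ p * ∑ i, 1 / q i * x i ^ q i := by
  have h := Real.geom_mean_le_arith_mean_weighted Finset.univ (fun i => p / q i)
    (fun i => x i ^ q i) (fun i _ => (div_pos hp (hq i)).le)
    (by
      have : ∀ i, p / q i = p * (1 / q i) := fun i => by ring
      simp only [this]
      rw [← Finset.mul_sum, ← hpq, mul_one_div_cancel hp.ne'])
    (fun i _ => Real.rpow_nonneg (hx i) _)
  rw [← Real.finsetProd_rpow _ _ fun i _ => hx i, Finset.mul_sum]
  convert h using 2 with i _ i _
  · rw [← Real.rpow_mul (hx i), mul_div_cancel₀ _ (hq i).ne']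
  · ring

end PowerSums

/-! ### Schatten norms and the lower bound -/

section SchattenNorm

variable {m n : ℕ}

theorem schattenNorm_rpow_eq_sum_min {p : ℝ} (hp : 0 < p) (X : Matrix (Fin m) (Fin n) ℝ) :
    schattenNorm p X ^ p = ∑ k ∈ Finset.range (min m n), matrixSingularValue X k ^ p := by
  rw [schattenNorm, ← Real.rpow_mul (Finset.sum_nonneg fun k _ =>
    Real.rpow_nonneg (matrixSingularValue_nonneg X k) p), one_div_mul_cancel hp.ne', Real.rpow_one]

theorem sum_range_matrixSingularValue_rpow {p : ℝ} (hp : 0 < p) (X : Matrix (Fin m) (Fin n) ℝ)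
    {N : ℕ} (hN : X.rank ≤ N) :
    ∑ k ∈ Finset.range N, matrixSingularValue X k ^ p =
      ∑ k ∈ Finset.range X.rank, matrixSingularValue X k ^ p := by
  refine (Finset.sum_subset (Finset.range_subset_range.mpr hN) fun k _ hk => ?_).symm
  rw [matrixSingularValue_eq_zero X (by simpa using hk), Real.zero_rpow hp.ne']

theorem rank_le_min (X : Matrix (Fin m) (Fin n) ℝ) : X.rank ≤ min m n :=
  le_min (by simpa using X.rank_le_height) (by simpa using X.rank_le_width)

/-- Any number of terms at least the rank gives the Schatten norm: the others vanish. -/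
theorem schattenNorm_rpow_eq_sum {p : ℝ} (hp : 0 < p) (X : Matrix (Fin m) (Fin n) ℝ)
    {N : ℕ} (hN : X.rank ≤ N) :
    schattenNorm p X ^ p = ∑ k ∈ Finset.range N, matrixSingularValue X k ^ p := by
  rw [schattenNorm_rpow_eq_sum_min hp, sum_range_matrixSingularValue_rpow hp X (rank_le_min X),
    sum_range_matrixSingularValue_rpow hp X hN]

theorem sum_le_schattenNorm_rpow {p : ℝ} (hp : 0 < p) (X : Matrix (Fin m) (Fin n) ℝ) (N : ℕ) :
    ∑ k ∈ Finset.range N, matrixSingularValue X k ^ p ≤ schattenNorm p X ^ p := by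
  rw [schattenNorm_rpow_eq_sum hp X (le_max_right N X.rank)]
  exact Finset.sum_le_sum_of_subset_of_nonneg (Finset.range_subset_range.mpr (le_max_left _ _))
    fun k _ _ => Real.rpow_nonneg (matrixSingularValue_nonneg X k) p

/-- The surrogate is bounded below by the Schatten norm of the product. Only the first `rank` of
the product many singular values matter, which makes all logarithms finite. -/
theorem FactorChain.schattenNorm_prod_le {I : ℕ} {d : Fin (I + 1) → ℕ} (A : FactorChain d)
    {p : ℝ} {q : Fin I → ℝ} (hp : 0 < p) (hq : ∀ i, 0 < q i) (hpq : 1 / p = ∑ i, 1 / q i) :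
    1 / p * schattenNorm p A.prod ^ p ≤ ∑ i, 1 / q i * schattenNorm (q i) (A i) ^ q i := by
  set r := A.prod.rank with hr
  have hσ : ∀ i j, 0 ≤ matrixSingularValue (A i) j := fun i => matrixSingularValue_nonneg (A i)
  have hX := matrixSingularValue_nonneg A.prod
  have hA : ∀ j, 0 ≤ ∏ i, matrixSingularValue (A i) j := fun j =>
    Finset.prod_nonneg fun i _ => hσ i j
  have h1 : ∑ j ∈ Finset.range r, matrixSingularValue A.prod j ^ p ≤
      ∑ j ∈ Finset.range r, (∏ i, matrixSingularValue (A i) j) ^ p := by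
    refine sum_le_sum_of_prod_le_prod ?_ r ?_ ?_ ?_ ?_
    · exact fun i j hij => Real.rpow_le_rpow (hX j) (matrixSingularValue_antitone _ hij) hp.le
    · exact fun j hj => Real.rpow_pos_of_pos ((matrixSingularValue_pos_iff _ j).mpr hj) p
    · exact fun j => Real.rpow_nonneg (hX j) p
    · exact fun j => Real.rpow_nonneg (hA j) p
    · intro k _
      rw [Real.finsetProd_rpow _ _ fun j _ => hX j, Real.finsetProd_rpow _ _ fun j _ => hA j]
      exact Real.rpow_le_rpow (Finset.prod_nonneg fun j _ => hX j)
        (A.prod_matrixSingularValue_le k) hp.le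
  rw [schattenNorm_rpow_eq_sum hp A.prod hr.ge, one_div_mul_eq_div, div_le_iff₀' hp]
  calc _ ≤ _ := h1
    _ ≤ ∑ j ∈ Finset.range r, p * ∑ i, 1 / q i * matrixSingularValue (A i) j ^ q i :=
        Finset.sum_le_sum fun j _ => prod_rpow_le_sum_rpow hp hq hpq _ fun i => hσ i j
    _ = p * ∑ i, 1 / q i * ∑ j ∈ Finset.range r, matrixSingularValue (A i) j ^ q i := by
        rw [← Finset.mul_sum, Finset.sum_comm]
        simp only [Finset.mul_sum]
    _ ≤ _ := by
        refine mul_le_mul_of_nonneg_left (Finset.sum_le_sum fun i _ => ?_) hp.le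
        exact mul_le_mul_of_nonneg_left (sum_le_schattenNorm_rpow (hq i) _ _)
          (one_div_pos.mpr (hq i)).le

end SchattenNorm

/-! ### Existence of singular value decompositions and norms of diagonal matrices -/

section SVD

variable {m n : ℕ}

theorem mul_rectDiagonal_apply (U : Matrix (Fin m) (Fin m) ℝ) (s : ℕ → ℝ) (i : Fin m)
    (j : Fin n) :
    (U * rectDiagonal m n s) i j = if h : (j : ℕ) < m then U i ⟨j, h⟩ * s j else 0 := by
  simp only [Matrix.mul_apply, rectDiagonal, Matrix.of_apply, mul_ite, mul_zero]
  split_ifs with h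
  · rw [Finset.sum_eq_single ⟨j, h⟩]
    · simp
    · intro l _ hl
      exact if_neg fun h' => hl (Fin.ext h')
    · simp
  · exact Finset.sum_eq_zero fun l _ => if_neg (by have := l.2; omega)

theorem OrthonormalBasis.of_mem_orthogonalGroup
    (b : OrthonormalBasis (Fin m) ℝ (EuclideanSpace ℝ (Fin m))) :
    (Matrix.of fun i j => b j i) ∈ Matrix.orthogonalGroup (Fin m) ℝ := by
  convert (EuclideanSpace.basisFun (Fin m) ℝ).toMatrix_orthonormalBasis_mem_orthogonal b using 1
  ext i j
  simp [Module.Basis.toMatrix_apply]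

/-- `V` consists of the right singular vectors `v j`, and `U` of an orthonormal basis extending the
vectors `σ_j⁻¹ • X v_j` with `σ_j ≠ 0`. -/
theorem exists_isSVD (X : Matrix (Fin m) (Fin n) ℝ) : ∃ U V, IsSVD X U V := by
  set T := Matrix.toEuclideanLin X with hT
  set v : OrthonormalBasis (Fin n) ℝ (EuclideanSpace ℝ (Fin n)) :=
    (rightSingularBasis T).reindex (finCongr finrank_euclideanSpace_fin) with hv
  have hin : ∀ i w, ⟪T (v i), T w⟫ = matrixSingularValue X i ^ 2 * ⟪v i, w⟫ := by
    intro i w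
    change _ = T.singularValues i ^ 2 * _
    have := inner_map_rightSingularBasis T ((finCongr finrank_euclideanSpace_fin).symm i) w
    simpa [hv] using this
  have hrm : X.rank ≤ m := (rank_le_min X).trans (min_le_left _ _)
  have hrn : X.rank ≤ n := (rank_le_min X).trans (min_le_right _ _)
  have hTv : ∀ j : Fin n, X.rank ≤ j → T (v j) = 0 := by
    intro j hj
    rw [← inner_self_eq_zero (𝕜 := ℝ), hin, matrixSingularValue_eq_zero X hj]
    simp
  -- The left singular vectors belonging to positive singular values.
  let u : Fin m → EuclideanSpace ℝ (Fin m) := fun j =>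
    if h : (j : ℕ) < n then (matrixSingularValue X j)⁻¹ • T (v ⟨j, h⟩) else 0
  have hu : Orthonormal ℝ (Set.domRestrict {j : Fin m | (j : ℕ) < X.rank} u) := by
    rw [orthonormal_iff_ite]
    rintro ⟨i, hi⟩ ⟨j, hj⟩
    have hi' : (i : ℕ) < n := lt_of_lt_of_le hi hrn
    have hj' : (j : ℕ) < n := lt_of_lt_of_le hj hrn
    have hpos := (matrixSingularValue_pos_iff X i).mpr hi
    have hvv := orthonormal_iff_ite.mp v.orthonormal ⟨i, hi'⟩ ⟨j, hj'⟩
    simp only [Set.domRestrict_apply, u, hi', hj', dif_pos, inner_smul_left, inner_smul_right,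
      hin, hvv, Subtype.mk.injEq, Fin.mk.injEq, Fin.val_inj]
    split_ifs with hij
    · subst hij
      simp only [conj_trivial]
      field_simp
    · simp
  obtain ⟨b, hb⟩ := hu.exists_orthonormalBasis_extension_of_card_eq (by simp)
  refine ⟨_, _, b.of_mem_orthogonalGroup, v.of_mem_orthogonalGroup, ?_⟩
  have hVV := (Matrix.mem_orthogonalGroup_iff (Fin n) ℝ).mp v.of_mem_orthogonalGroup
  have hXV : X * (Matrix.of fun i j => v j i) =
      (Matrix.of fun i j => b j i) * rectDiagonal m n (matrixSingularValue X) := by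
    ext i j
    rw [mul_rectDiagonal_apply]
    have hTe : (X * (Matrix.of fun i j => v j i)) i j = T (v j) i := by
      simp [hT, Matrix.mul_apply, Matrix.toLpLin_apply, Matrix.mulVec, dotProduct]
    rw [hTe]
    rcases lt_or_ge (j : ℕ) X.rank with hj | hj
    · have hpos := (matrixSingularValue_pos_iff X j).mpr hj
      rw [dif_pos (hj.trans_le hrm), Matrix.of_apply, hb _ (by exact hj)]
      simp only [u, Fin.is_lt, dif_pos, Fin.eta, PiLp.smul_apply, smul_eq_mul]
      field_simp
    · rw [hTv j hj, matrixSingularValue_eq_zero X hj]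
      simp
  rw [← hXV, Matrix.mul_assoc]
  have : (Matrix.of fun i j => v j i) * (Matrix.of fun i j => v j i).transpose = 1 := hVV
  rw [this, Matrix.mul_one]

theorem rectDiagonal_transpose_mul_self (s : ℕ → ℝ) :
    (rectDiagonal m n s).transpose * rectDiagonal m n s =
      Matrix.diagonal fun j : Fin n => if (j : ℕ) < m then s j ^ 2 else 0 := by
  ext i j
  simp only [Matrix.mul_apply, Matrix.transpose_apply, rectDiagonal, Matrix.of_apply,
    Matrix.diagonal_apply, mul_ite, mul_zero, ite_mul, zero_mul]
  split_ifs with hij hi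
  · subst hij
    rw [Finset.sum_eq_single ⟨i, hi⟩]
    · simp [pow_two]
    · intro l _ hl
      rw [if_neg fun h' => hl (Fin.ext h')]
    · simp
  · refine Finset.sum_eq_zero fun l _ => ?_
    rw [if_neg (by have := l.2; omega)]
  · refine Finset.sum_eq_zero fun l _ => ?_
    split_ifs with h1 h2
    · exact absurd (Fin.ext (h2.symm.trans h1)) hij
    · rfl
    · rfl

/-- The squared singular values, as a multiset, depend only on the characteristic polynomial of
`Bᵀ * B`; this suffices for evaluating symmetric functions of them, such as Schatten norms. -/
theorem map_sq_matrixSingularValue_eq_roots_charpoly (B : Matrix (Fin m) (Fin n) ℝ) :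
    Finset.univ.val.map (fun i : Fin n => matrixSingularValue B i ^ 2) =
      (B.transpose * B).charpoly.roots := by
  set T := Matrix.toEuclideanLin B with hT
  have hcomp : LinearMap.adjoint T ∘ₗ T = Matrix.toEuclideanLin (B.transpose * B) := by
    rw [hT, ← Matrix.toEuclideanLin_conjTranspose_eq_adjoint]
    ext x : 1
    simp [Matrix.toLpLin_apply, Matrix.mulVec_mulVec, Matrix.conjTranspose_eq_transpose_of_trivial]
  have hchar : (LinearMap.adjoint T ∘ₗ T).charpoly = (B.transpose * B).charpoly := by
    rw [hcomp, Matrix.toEuclideanLin_eq_toLin_orthonormal, Matrix.charpoly_toLin]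
  rw [← hchar, T.isSymmetric_adjoint_comp_self.roots_charpoly_eq_eigenvalues
    finrank_euclideanSpace_fin]
  refine Multiset.map_congr rfl fun i _ => ?_
  exact T.sq_singularValues_fin finrank_euclideanSpace_fin i

theorem schattenNorm_rpow_orthogonal_mul_rectDiagonal {q : ℝ} (hq : 0 < q)
    {U : Matrix (Fin m) (Fin m) ℝ} {V : Matrix (Fin n) (Fin n) ℝ}
    (hU : U ∈ Matrix.orthogonalGroup (Fin m) ℝ) (hV : V ∈ Matrix.orthogonalGroup (Fin n) ℝ)
    {s : ℕ → ℝ} (hs : ∀ j, 0 ≤ s j) :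
    schattenNorm q (U * rectDiagonal m n s * V.transpose) ^ q =
      ∑ j ∈ Finset.range (min m n), s j ^ q := by
  set B := U * rectDiagonal m n s * V.transpose with hB
  have hU' : U.transpose * U = 1 := (Matrix.mem_orthogonalGroup_iff' (Fin m) ℝ).mp hU
  have hV' : V.transpose * V = 1 := (Matrix.mem_orthogonalGroup_iff' (Fin n) ℝ).mp hV
  have hBB : B.transpose * B =
      V * ((Matrix.diagonal fun j : Fin n => if (j : ℕ) < m then s j ^ 2 else 0) * V.transpose) := by
    rw [← rectDiagonal_transpose_mul_self, hB]
    simp only [Matrix.transpose_mul, Matrix.transpose_transpose, Matrix.mul_assoc]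
    rw [← Matrix.mul_assoc U.transpose, hU', Matrix.one_mul]
  have hroots := map_sq_matrixSingularValue_eq_roots_charpoly B
  rw [hBB, Matrix.charpoly_mul_comm, Matrix.mul_assoc, hV', Matrix.mul_one,
    Matrix.charpoly_diagonal, Polynomial.roots_prod _ _
      (by simp [Finset.prod_ne_zero_iff, Polynomial.X_sub_C_ne_zero])] at hroots
  simp only [Polynomial.roots_X_sub_C, Multiset.bind_singleton] at hroots
  have hsum := congrArg (fun M => (M.map fun x => √x ^ q).sum) hroots
  simp only [Multiset.map_map, Function.comp_def,
    Real.sqrt_sq (matrixSingularValue_nonneg B _)] at hsum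
  change ∑ i : Fin n, matrixSingularValue B i ^ q =
    ∑ i : Fin n, √(if (i : ℕ) < m then s i ^ 2 else 0) ^ q at hsum
  rw [schattenNorm_rpow_eq_sum hq B ((rank_le_min B).trans (min_le_right _ _)),
    ← Fin.sum_univ_eq_sum_range, hsum,
    Fin.sum_univ_eq_sum_range (fun i => √(if i < m then s i ^ 2 else 0) ^ q)]
  symm
  refine Finset.sum_subset_zero_on_sdiff (Finset.range_subset_range.mpr (min_le_right _ _)) ?_ ?_
  · intro j hj
    simp only [Finset.mem_sdiff, Finset.mem_range, lt_min_iff] at hj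
    rw [if_neg (by tauto), Real.sqrt_zero, Real.zero_rpow hq.ne']
  · intro j hj
    rw [if_pos (by simp at hj; exact hj.1), Real.sqrt_sq (hs j)]

end SVD

/-! ### Attainment -/

section Attainment

theorem rectDiagonal_mul_rectDiagonal {a b c : ℕ} {s t : ℕ → ℝ}
    (h : ∀ j, b ≤ j → j < c → s j * t j = 0) :
    rectDiagonal a b s * rectDiagonal b c t = rectDiagonal a c fun j => s j * t j := by
  ext i j
  simp only [Matrix.mul_apply, rectDiagonal, Matrix.of_apply, mul_ite, mul_zero, ite_mul, zero_mul]
  rcases lt_or_ge (j : ℕ) b with hj | hj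
  · rw [Finset.sum_eq_single ⟨j, hj⟩]
    · simp only [if_true]
      split_ifs with hij
      · rw [hij]
      · rfl
    · intro l _ hl
      exact if_neg fun h' => hl (Fin.ext h')
    · simp
  · rw [Finset.sum_eq_zero fun l _ => if_neg (by have := l.2; omega)]
    split_ifs with hij
    · rw [hij, h j hj j.2]
    · rfl

/-- Rectangular diagonal matrices multiply entrywise along a chain, provided that no inner dimension
cuts off a nonzero entry. -/
theorem FactorChain.prod_rectDiagonal {I : ℕ} (d : Fin (I + 1) → ℕ) (s : Fin I → ℕ → ℝ)
    (h : ∀ l : Fin (I + 1), l ≠ 0 → l ≠ Fin.last I → ∀ j, d l ≤ j → ∀ i, s i j = 0) :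
    FactorChain.prod (d := d) (fun i => rectDiagonal (d i.castSucc) (d i.succ) (s i)) =
      rectDiagonal (d 0) (d (Fin.last I)) fun j => ∏ i, s i j := by
  induction I with
  | zero =>
    ext i j
    simp [FactorChain.prod, rectDiagonal, Matrix.one_apply, Fin.ext_iff]
  | succ I ih =>
    have ih' := ih (fun i => d i.succ) (fun i => s i.succ) fun l _ hl' j hj i =>
      h l.succ (Fin.succ_ne_zero l) (fun e => hl' (Fin.succ_injective _ (by simpa using e))) j hj _
    rw [FactorChain.prod]
    refine (congrArg (rectDiagonal (d (Fin.castSucc 0)) (d (Fin.succ 0)) (s 0) * ·) ih').trans ?_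
    refine (rectDiagonal_mul_rectDiagonal fun j hj hj' => ?_).trans ?_
    -- If the next node is the last one, there are no indices `j` between the two dimensions.
    · have hne : (Fin.succ 0 : Fin (I + 2)) ≠ Fin.last (I + 1) := by
        intro e
        have : d (Fin.succ 0) = d (Fin.last I).succ := by rw [e, Fin.succ_last]
        exact absurd hj (by simp only [this] at *; omega)
      rw [h _ (Fin.succ_ne_zero 0) hne j hj, zero_mul]
    · simp only [Fin.prod_univ_succ]
      rfl

/-- Orthogonal changes of basis at the inner nodes of a chain cancel in the product. -/
theorem FactorChain.prod_conj {I : ℕ} (d : Fin (I + 1) → ℕ) (A : FactorChain d)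
    (W : (j : Fin (I + 1)) → Matrix (Fin (d j)) (Fin (d j)) ℝ)
    (hW : ∀ j, W j ∈ Matrix.orthogonalGroup (Fin (d j)) ℝ) :
    FactorChain.prod (d := d) (fun i => W i.castSucc * A i * (W i.succ).transpose) =
      W 0 * A.prod * (W (Fin.last I)).transpose := by
  induction I with
  | zero =>
    have : W 0 * (W 0).transpose = 1 := (Matrix.mem_orthogonalGroup_iff _ ℝ).mp (hW 0)
    simp only [FactorChain.prod, Matrix.mul_one]
    exact this.symm
  | succ I ih =>
    have ih' := ih (fun i => d i.succ) (fun i => A i.succ) (fun i => W i.succ) fun j => hW j.succ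
    have h1 : (W (Fin.succ 0)).transpose * W (Fin.succ 0) = 1 :=
      (Matrix.mem_orthogonalGroup_iff' _ ℝ).mp (hW (Fin.succ 0))
    rw [FactorChain.prod]
    refine (congrArg (W (Fin.castSucc 0) * A 0 * (W (Fin.succ 0)).transpose * ·) ih').trans ?_
    rw [FactorChain.prod]
    have key : ∀ {a b c e : ℕ} (P : Matrix (Fin a) (Fin b) ℝ) (Q : Matrix (Fin b) (Fin b) ℝ)
        (R : Matrix (Fin b) (Fin c) ℝ) (S : Matrix (Fin c) (Fin e) ℝ), Q.transpose * Q = 1 →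
        P * Q.transpose * (Q * R * S) = P * R * S := by
      intro a b c e P Q R S hQ
      simp only [Matrix.mul_assoc]
      rw [← Matrix.mul_assoc Q.transpose, hQ, Matrix.one_mul]
    exact (key _ _ _ _ h1).trans
      (congrArg (· * (W (Fin.last I).succ).transpose) (Matrix.mul_assoc _ _ _))

/-- Distributing powers of the singular values over the factors of a chain whose inner dimensions
are at least the rank gives a factorization of `X` at which the bound is attained. -/
theorem exists_factorChain_of_isSVD (k : ℕ) (d : Fin (k + 2 + 1) → ℕ)
    (X : Matrix (Fin (d 0)) (Fin (d (Fin.last (k + 2)))) ℝ)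
    (hrank : ∀ i : Fin (k + 2 + 1), i ≠ 0 → i ≠ Fin.last (k + 2) → X.rank ≤ d i)
    (p : ℝ) (q : Fin (k + 2) → ℝ) (hp : 0 < p) (hq : ∀ i, 0 < q i)
    (hpq : 1 / p = ∑ i, 1 / q i)
    (U : Matrix (Fin (d 0)) (Fin (d 0)) ℝ)
    (V : Matrix (Fin (d (Fin.last (k + 2)))) (Fin (d (Fin.last (k + 2)))) ℝ) (h : IsSVD X U V) :
    ∃ A : FactorChain d,
      A 0 = U * rectDiagonal (d 0) (d 1) (fun j => matrixSingularValue X j ^ (p / q 0)) ∧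
      (∀ i : Fin (k + 2), i ≠ 0 → i ≠ Fin.last (k + 1) →
        A i = rectDiagonal (d i.castSucc) (d i.succ)
          (fun j => matrixSingularValue X j ^ (p / q i))) ∧
      A (Fin.last (k + 1)) =
        rectDiagonal (d (Fin.last (k + 1)).castSucc) (d (Fin.last (k + 2)))
          (fun j => matrixSingularValue X j ^ (p / q (Fin.last (k + 1)))) * V.transpose ∧
      X = A.prod ∧
      ∑ i, 1 / q i * schattenNorm (q i) (A i) ^ q i = 1 / p * schattenNorm p X ^ p := by
  obtain ⟨hU, hV, hX⟩ := h
  have hσ := matrixSingularValue_nonneg X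
  have hpq' : ∀ i, 0 < p / q i := fun i => div_pos hp (hq i)
  -- Orthogonal matrices placed at the nodes of the chain: `U` and `V` at its ends, `1` inside.
  let W : (j : Fin (k + 2 + 1)) → Matrix (Fin (d j)) (Fin (d j)) ℝ :=
    Function.update (Function.update (fun _ => 1) 0 U) (Fin.last (k + 2)) V
  have hWl : W (Fin.last (k + 2)) = V := Function.update_self ..
  have hW0 : W 0 = U := by
    simp only [W]
    rw [Function.update_of_ne (Fin.last_pos.ne), Function.update_self]
  have hWi : ∀ j, j ≠ 0 → j ≠ Fin.last (k + 2) → W j = 1 := by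
    intro j h0 hl
    simp only [W]
    rw [Function.update_of_ne hl, Function.update_of_ne h0]
  have hW : ∀ j, W j ∈ Matrix.orthogonalGroup (Fin (d j)) ℝ := by
    intro j
    by_cases h0 : j = 0
    · subst h0; rwa [hW0]
    by_cases hl : j = Fin.last (k + 2)
    · subst hl; rwa [hWl]
    rw [hWi j h0 hl]
    exact one_mem _
  have hd : ∀ j, X.rank ≤ d j := by
    intro j
    by_cases h0 : j = 0
    · subst h0; exact (rank_le_min X).trans (min_le_left _ _)
    by_cases hl : j = Fin.last (k + 2)
    · subst hl; exact (rank_le_min X).trans (min_le_right _ _)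
    exact hrank j h0 hl
  let D : FactorChain d := fun i => rectDiagonal (d i.castSucc) (d i.succ)
    fun j => matrixSingularValue X j ^ (p / q i)
  have left_end : ∀ {a b : ℕ} {P P' : Matrix (Fin a) (Fin a) ℝ} {Q : Matrix (Fin b) (Fin b) ℝ}
      (R : Matrix (Fin a) (Fin b) ℝ), P = P' → Q = 1 → P * R * Q.transpose = P' * R := by
    rintro a b P P' Q R rfl rfl
    rw [Matrix.transpose_one, Matrix.mul_one]
  have right_end : ∀ {a b : ℕ} {P : Matrix (Fin a) (Fin a) ℝ} {Q Q' : Matrix (Fin b) (Fin b) ℝ}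
      (R : Matrix (Fin a) (Fin b) ℝ), P = 1 → Q = Q' →
      P * R * Q.transpose = R * Q'.transpose := by
    rintro a b P Q Q' R rfl rfl
    rw [Matrix.one_mul]
  refine ⟨fun i => W i.castSucc * D i * (W i.succ).transpose, ?_, ?_, ?_, ?_, ?_⟩
  · have h1 : W (Fin.succ 0) = 1 := hWi _ (Fin.succ_ne_zero 0) (by simp [Fin.ext_iff])
    exact left_end (D 0) hW0 h1
  · intro i h0 hl
    have h1 : W i.castSucc = 1 := hWi _ (by simpa using h0) (Fin.castSucc_lt_last i).ne
    have h2 : W i.succ = 1 := hWi _ (Fin.succ_ne_zero i) (by simpa using hl)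
    simp only [h1, h2, Matrix.transpose_one, Matrix.mul_one, Matrix.one_mul, D]
  · have h1 : W (Fin.last (k + 1)).castSucc = 1 :=
      hWi _ (by simp [Fin.ext_iff]) (Fin.castSucc_lt_last _).ne
    exact right_end (D (Fin.last (k + 1))) h1 hWl
  · have hs : ∀ j, ∏ i, matrixSingularValue X j ^ (p / q i) = matrixSingularValue X j := by
      intro j
      have hsum : ∑ i, p / q i = 1 := by
        have : ∀ i, p / q i = p * (1 / q i) := fun i => by ring
        simp only [this]
        rw [← Finset.mul_sum, ← hpq, mul_one_div_cancel hp.ne']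
      rw [← Real.rpow_sum_of_nonneg (hσ j) fun i _ => (hpq' i).le, hsum, Real.rpow_one]
    have hD := FactorChain.prod_rectDiagonal d (fun i j => matrixSingularValue X j ^ (p / q i))
      fun l _ _ j hj i => by
        rw [matrixSingularValue_eq_zero X ((hd l).trans hj), Real.zero_rpow (hpq' i).ne']
    rw [FactorChain.prod_conj d D W hW, hW0, hWl]
    simp only [hs] at hD
    rw [show D.prod = _ from hD]
    exact hX
  · rw [hpq, Finset.sum_mul]
    refine Finset.sum_congr rfl fun i _ => ?_
    rw [schattenNorm_rpow_orthogonal_mul_rectDiagonal (hq i) (hW _) (hW _)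
      fun j => Real.rpow_nonneg (hσ j) _, schattenNorm_rpow_eq_sum hp X (le_min (hd _) (hd _))]
    congr 1
    refine Finset.sum_congr rfl fun j _ => ?_
    rw [← Real.rpow_mul (hσ j), div_mul_cancel₀ _ (hq i).ne']

end Attainment

/-- The number of factors is `I = k + 2 ≥ 2`; the factors `A 0, …, A (k + 1)` have sizes
`d 0 × d 1, …, d (k + 1) × d (k + 2)`, where `d 0 = m` and `d (k + 2) = n`. -/
theorem corollary2 (k : ℕ) (d : Fin (k + 2 + 1) → ℕ)
    (X : Matrix (Fin (d 0)) (Fin (d (Fin.last (k + 2)))) ℝ)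
    (hrank : ∀ i : Fin (k + 2 + 1), i ≠ 0 → i ≠ Fin.last (k + 2) → X.rank ≤ d i)
    (p : ℝ) (q : Fin (k + 2) → ℝ) (hp : 0 < p) (hq : ∀ i, 0 < q i)
    (hpq : 1 / p = ∑ i, 1 / q i) :
    -- the value of the minimum
    IsLeast
      {c : ℝ | ∃ A : FactorChain d, X = A.prod ∧
        c = ∑ i, 1 / q i * schattenNorm (q i) (A i) ^ q i}
      (1 / p * schattenNorm p X ^ p) ∧
    -- it is attained by distributing powers of the singular values among the factors
    ∀ (U : Matrix (Fin (d 0)) (Fin (d 0)) ℝ)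
      (V : Matrix (Fin (d (Fin.last (k + 2)))) (Fin (d (Fin.last (k + 2)))) ℝ), IsSVD X U V →
      ∃ A : FactorChain d,
        A 0 = U * rectDiagonal (d 0) (d 1) (fun j => matrixSingularValue X j ^ (p / q 0)) ∧
        (∀ i : Fin (k + 2), i ≠ 0 → i ≠ Fin.last (k + 1) →
          A i = rectDiagonal (d i.castSucc) (d i.succ)
            (fun j => matrixSingularValue X j ^ (p / q i))) ∧
        A (Fin.last (k + 1)) =
          rectDiagonal (d (Fin.last (k + 1)).castSucc) (d (Fin.last (k + 2)))
            (fun j => matrixSingularValue X j ^ (p / q (Fin.last (k + 1)))) * V.transpose ∧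
        X = A.prod ∧
        ∑ i, 1 / q i * schattenNorm (q i) (A i) ^ q i = 1 / p * schattenNorm p X ^ p := by
  have hatt := exists_factorChain_of_isSVD k d X hrank p q hp hq hpq
  obtain ⟨U, V, h⟩ := exists_isSVD X
  refine ⟨⟨?_, ?_⟩, hatt⟩
  · obtain ⟨A, -, -, -, hA, hc⟩ := hatt U V h
    exact ⟨A, hA, hc.symm⟩
  · rintro c ⟨A, rfl, rfl⟩
    exact A.schattenNorm_prod_le hp hq hpq
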